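/- **Theorem 1 (Upper bound).** For quadratures $\hat\xi=(\hat x_a,\hat p_a,\hat x_b,\hat p_b)$ with $[\hat\xi_l,\hat\xi_m]=i(J\oplus J)_{lm}$, $J=\begin{pmatrix}0&1\\-1&0\end{pmatrix}$, let Alice (mode $a$) and Bob (mode $b$) share a zero-mean two-mode Gaussian state with covariance matrix $V_{lm}=\langle\hat\xi_l\hat\xi_m+\hat\xi_m\hat\xi_l\rangle$, i.e. a real symmetric $4\times4$ matrix with $V+i(J\oplus J)\ge 0$, so that the characteristic function of the state is $\Phi(\xi)=\exp(-\xi^TV\xi/4)$. Let $Z=\mathrm{diag}(1,-1)$, $\Lambda=Z\oplus I$, and let $\nu$ be the lowest symplectic eigenvalue of the partially transposed covariance matrix $\Lambda V\Lambda$, that is, the smallest absolute value of an eigenvalue of $i(J\oplus J)\Lambda V\Lambda$. Assume $\nu\le 1$ (for instance, that the state is entangled, $\nu<1$). For a shared zero-mean Gaussian state with characteristic function $\Phi$, Braunstein–Kimble teleportation of a coherent state with characteristic function $\Phi_{in}(\xi)=\exp(-|\xi|^2/4+i\,d\cdot\xi)$, $d\in\mathbb R^2$, leaves Bob's mode in the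 state with characteristic function $\Phi_{out}(\xi)=\Phi_{in}(\xi)\,\Phi(Z\xi,\xi)$ (his output quadratures are $\hat x_b+\hat x_a+\hat x_{in}$ and $\hat p_b-\hat p_a+\hat p_{in}$), and the fidelity is $\mathcal F=\mathrm{Tr}[\rho_{in}\rho_{out}]=\frac1{2\pi}\int_{\mathbb R^2}\Phi_{in}(-\xi)\Phi_{out}(\xi)\,d^2\xi$. Before teleportation, Alice and Bob may each apply a local Gaussian completely positive map, not necessarily trace preserving, of one mode to one mode: add finitely many ancillary modes in a Gaussian state, apply a Gaussian unitary to the own mode and the ancillas, and then discard some of the ancillas, project others onto a Gaussian state, and subject others to ideal homodyne detection; the mean of the resulting state is reset to zero. Let $\mathcal F_{opt}$ be the supremum of the fidelity over all pairs of such local maps. Then, for every input coherent state, every pair of local Gaussian completely positive maps gives $\mathcal F\le\frac1{1+\nu}$, and hence $$\mathcal F_{opt}\le\frac{1}{1+\nu}.$$ -/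

import Mathlib

noncomputable section

namespace CVTeleportation

open Matrix
open scoped ComplexOrder

/-! ### Phase space of bosonic modes

A mode has the two quadratures `x` (index `0`) and `p` (index `1`).  A system of several modes has
its quadratures indexed by a finite type, and its canonical commutation relations
`[ξ̂ₗ, ξ̂ₘ] = i Ωₗₘ` are given by a real antisymmetric matrix `Ω`.  Composite systems are indexed
by sum types, with block diagonal commutation matrix. -/

/-- The commutation matrix of a single mode. -/
def J : Matrix (Fin 2) (Fin 2) ℝ := !![0, 1; -1, 0]

/-- The reflection of the momentum of a single mode. -/
def Z : Matrix (Fin 2) (Fin 2) ℝ := !![1, 0; 0, -1]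

/-- The direct sum of two real square matrices. -/
def dsum {ι κ : Type} (A : Matrix ι ι ℝ) (B : Matrix κ κ ℝ) : Matrix (ι ⊕ κ) (ι ⊕ κ) ℝ :=
  Matrix.fromBlocks A 0 0 B

/-- The commutation matrix of `k` modes; the index `(m, i)` is quadrature `i` of mode `m`. -/
def modesForm (k : ℕ) : Matrix (Fin k × Fin 2) (Fin k × Fin 2) ℝ :=
  fun a b => if a.1 = b.1 then J a.2 b.2 else 0

/-- `V` is the covariance matrix of a Gaussian state of the system with commutation matrix `Ω`: it
is real symmetric and obeys the uncertainty principle `V + i Ω ≥ 0`.  The convention is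
`Vₗₘ = ⟨Δξ̂ₗ Δξ̂ₘ + Δξ̂ₘ Δξ̂ₗ⟩`, so the vacuum has covariance matrix `1`. -/
def IsCovariance {ι : Type} [Fintype ι] (Ω V : Matrix ι ι ℝ) : Prop :=
  V.IsSymm ∧ (V.map Complex.ofReal + Complex.I • Ω.map Complex.ofReal).PosSemidef

/-- `S` is a symplectic matrix, i.e. the linear map `ξ̂ ↦ S ξ̂` implemented by a Gaussian unitary. -/
def IsSymplectic {ι : Type} [Fintype ι] (Ω S : Matrix ι ι ℝ) : Prop :=
  S * Ω * Sᵀ = Ω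

/-! ### Local Gaussian completely positive maps -/

/-- Quadratures of the ancillary modes of a Gaussian operation: `nd` modes that are finally
discarded, `np` modes that are finally projected onto a Gaussian state, and `nh` modes that are
finally subject to ideal homodyne detection of their `x` quadrature. -/
abbrev Anc (nd np nh : ℕ) : Type :=
  (Fin nd × Fin 2) ⊕ ((Fin np × Fin 2) ⊕ (Fin nh × Fin 2))

/-- Commutation matrix of the ancillary modes. -/
def ancForm (nd np nh : ℕ) : Matrix (Anc nd np nh) (Anc nd np nh) ℝ :=
  dsum (modesForm nd) (dsum (modesForm np) (modesForm nh))

/-- A Gaussian completely positive (in general not trace-preserving) map of one mode into one mode: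
add ancillary modes in a Gaussian state with covariance matrix `σ`, apply a Gaussian unitary with
symplectic matrix `S` to the mode together with the ancillas, then discard some of the ancillas,
project others onto a Gaussian state with covariance matrix `γ`, and measure others by homodyne
detection.  Without measured ancillas this is a trace-preserving Gaussian map. -/
structure GCPMap where
  /-- number of discarded ancillary modes -/
  nd : ℕ
  /-- number of ancillary modes projected onto a Gaussian state -/
  np : ℕ
  /-- number of homodyned ancillary modes -/
  nh : ℕ
  /-- covariance matrix of the initial state of the ancillas -/
  σ : Matrix (Anc nd np nh) (Anc nd np nh) ℝ
  hσ : IsCovariance (ancForm nd np nh) σ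
  /-- symplectic matrix of the Gaussian unitary -/
  S : Matrix (Fin 2 ⊕ Anc nd np nh) (Fin 2 ⊕ Anc nd np nh) ℝ
  hS : IsSymplectic (dsum J (ancForm nd np nh)) S
  /-- covariance matrix of the Gaussian state onto which ancillas are projected -/
  γ : Matrix (Fin np × Fin 2) (Fin np × Fin 2) ℝ
  hγ : IsCovariance (modesForm np) γ

namespace GCPMap

/-- Phase space of the mode together with the ancillas. -/
abbrev Total (E : GCPMap) : Type := Fin 2 ⊕ Anc E.nd E.np E.nh

/-- Labels of the measured quadratures: both quadratures of every projected mode, and the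
`x` quadrature of every homodyned mode. -/
abbrev Meas (E : GCPMap) : Type := (Fin E.np × Fin 2) ⊕ Fin E.nh

/-- The measured quadratures, inside the phase space of the mode and the ancillas. -/
def meas (E : GCPMap) : E.Meas → E.Total
  | Sum.inl q => Sum.inr (Sum.inr (Sum.inl q))
  | Sum.inr h => Sum.inr (Sum.inr (Sum.inr (h, 0)))

/-- Covariance contributed by the measurement: `γ` for the projected modes and nothing for ideal
homodyne detection. -/
def measCov (E : GCPMap) : Matrix E.Meas E.Meas ℝ := dsum E.γ 0

end GCPMap

/-- The covariance matrix of all modes of Alice and of Bob when, starting from a two-mode state `V`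
(Alice's mode first), both have added their ancillas and applied their Gaussian unitaries. -/
def dilatedCov (EA EB : GCPMap) (V : Matrix (Fin 2 ⊕ Fin 2) (Fin 2 ⊕ Fin 2) ℝ) :
    Matrix (EA.Total ⊕ EB.Total) (EA.Total ⊕ EB.Total) ℝ :=
  dsum EA.S EB.S *
    Matrix.reindex (Equiv.sumSumSumComm _ _ _ _) (Equiv.sumSumSumComm _ _ _ _)
      (dsum V (dsum EA.σ EB.σ)) *
    (dsum EA.S EB.S)ᵀ

/-- The output covariance matrix of the local Gaussian map `EA ⊗ EB` on a two-mode Gaussian state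
with covariance matrix `V`: the conditional covariance matrix of the two output modes, given the
results of the Gaussian measurements on the ancillas.  It does not depend on these results, which
only displace the output state. -/
def localGCP (EA EB : GCPMap) (V : Matrix (Fin 2 ⊕ Fin 2) (Fin 2 ⊕ Fin 2) ℝ) :
    Matrix (Fin 2 ⊕ Fin 2) (Fin 2 ⊕ Fin 2) ℝ :=
  let W := dilatedCov EA EB V
  let out : Fin 2 ⊕ Fin 2 → EA.Total ⊕ EB.Total := Sum.map Sum.inl Sum.inl
  let mea : EA.Meas ⊕ EB.Meas → EA.Total ⊕ EB.Total := Sum.map EA.meas EB.meas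
  W.submatrix out out -
    W.submatrix out mea * (W.submatrix mea mea + dsum EA.measCov EB.measCov)⁻¹ *
      W.submatrix mea out

/-! ### The teleportation protocol -/

/-- The Wigner characteristic function `Tr[ρ exp(-i ξ · ξ̂)] = exp(-ξᵀ V ξ / 4 + i d · ξ)` of the
Gaussian state with covariance matrix `V` and displacement parameter `d`. -/
def gaussianChar {ι : Type} [Fintype ι] (V : Matrix ι ι ℝ) (d : ι → ℝ) (ξ : ι → ℝ) : ℂ :=
  Complex.exp (-((ξ ⬝ᵥ V *ᵥ ξ : ℝ) : ℂ) / 4 + Complex.I * ((d ⬝ᵥ ξ : ℝ) : ℂ))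

/-- The characteristic function of Bob's output mode.  After the homodyne measurements of
`(x_a + x_in) / √2` and `(p_in - p_a) / √2` by Alice and the conditional displacements by Bob, the
quadratures of his mode are `x_b + x_a + x_in` and `p_b - p_a + p_in`. -/
def teleportedChar (Φin : (Fin 2 → ℝ) → ℂ) (Φab : (Fin 2 ⊕ Fin 2 → ℝ) → ℂ) (ξ : Fin 2 → ℝ) : ℂ :=
  Φin ξ * Φab (Sum.elim (Z *ᵥ ξ) ξ)

/-- The overlap `Tr[ρ₁ ρ₂]` of two one-mode states, through their characteristic functions. -/
def overlap (Φ₁ Φ₂ : (Fin 2 → ℝ) → ℂ) : ℂ :=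
  (1 / (2 * Real.pi) : ℝ) * ∫ ξ : Fin 2 → ℝ, Φ₁ (-ξ) * Φ₂ ξ

/-- The fidelity `⟨ψ_in| ρ_out |ψ_in⟩ = Tr[ρ_in ρ_out]` of the teleportation of the coherent state
with displacement parameter `d`, when the shared state is the Gaussian state with zero mean and
covariance matrix `V`. -/
def fidelity (V : Matrix (Fin 2 ⊕ Fin 2) (Fin 2 ⊕ Fin 2) ℝ) (d : Fin 2 → ℝ) : ℝ :=
  (overlap (gaussianChar 1 d) (teleportedChar (gaussianChar 1 d) (gaussianChar V 0))).re

/-- The optimal fidelity: the supremum over all local Gaussian completely positive maps. -/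
def optimalFidelity (V : Matrix (Fin 2 ⊕ Fin 2) (Fin 2 ⊕ Fin 2) ℝ) (d : Fin 2 → ℝ) : ℝ :=
  sSup {F : ℝ | ∃ EA EB : GCPMap, F = fidelity (localGCP EA EB V) d}

/-! ### Entanglement -/

/-- The partially transposed covariance matrix. -/
def partialTranspose (V : Matrix (Fin 2 ⊕ Fin 2) (Fin 2 ⊕ Fin 2) ℝ) :
    Matrix (Fin 2 ⊕ Fin 2) (Fin 2 ⊕ Fin 2) ℝ :=
  dsum Z 1 * V * dsum Z 1

/-- The lowest symplectic eigenvalue of the partially transposed covariance matrix; the symplectic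
eigenvalues of `W` are the absolute values of the eigenvalues of `i (J ⊕ J) W`. -/
def lowestPTSymplecticEigenvalue (V : Matrix (Fin 2 ⊕ Fin 2) (Fin 2 ⊕ Fin 2) ℝ) : ℝ :=
  sInf {s : ℝ | ∃ z ∈ spectrum ℂ
    (Complex.I • (dsum J J * partialTranspose V).map Complex.ofReal), s = ‖z‖}

end CVTeleportation

end

noncomputable section

namespace CVTeleportation

open Matrix
open scoped ComplexOrder

/-! ### Uncertainty relations -/

section Uncertainty

variable {ι κ : Type}

/-! Partial transposition turns the definition of ν into an uncertainty relation for V itself, with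
Alice's commutators reversed and both parties' scaled: V + iν(-J ⊕ J) ≥ 0
(`posSemidef_lowestPTSymplecticEigenvalue`). Since ν ≤ 1, local Gaussian maps preserve it
(`localGCP_posSemidef`): every ancilla and every projection also obeys its own relation scaled by a
factor in [-1, 1], symplectic maps fix the scaled forms, and conditioning is a Schur complement.

For the output state, the covariance N of x_b + x_a and p_b - p_a then satisfies N + 2iνJ ≥ 0
(`noiseCov_posSemidef`). Hence det N ≥ 4ν² and tr N ≥ 4ν, so det(2 + N) ≥ 4(1 + ν)², while a
Gaussian integral gives the fidelity 2/√det(2 + N) (`fidelity_eq`). -/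

/-- The complex matrix `V + i Ω`. -/
def uncertaintyMatrix (V Ω : Matrix ι ι ℝ) : Matrix ι ι ℂ :=
  V.map Complex.ofReal + Complex.I • Ω.map Complex.ofReal

lemma uncertaintyMatrix_apply (V Ω : Matrix ι ι ℝ) (i j : ι) :
    uncertaintyMatrix V Ω i j = V i j + Complex.I * Ω i j := rfl

lemma uncertaintyMatrix_add (V V' Ω Ω' : Matrix ι ι ℝ) :
    uncertaintyMatrix (V + V') (Ω + Ω') = uncertaintyMatrix V Ω + uncertaintyMatrix V' Ω' := by
  ext i j
  simp [uncertaintyMatrix_apply]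
  ring

lemma uncertaintyMatrix_smul (c : ℝ) (V Ω : Matrix ι ι ℝ) :
    uncertaintyMatrix (c • V) (c • Ω) = (c : ℂ) • uncertaintyMatrix V Ω := by
  ext i j
  simp [uncertaintyMatrix_apply]
  ring

lemma isSymm_of_posSemidef {V Ω : Matrix ι ι ℝ} (h : (uncertaintyMatrix V Ω).PosSemidef) :
    Vᵀ = V ∧ Ωᵀ = -Ω := by
  have key : ∀ i j, V j i = V i j ∧ Ω j i = -Ω i j := fun i j => by
    have := h.1.apply i j
    simp only [uncertaintyMatrix_apply, Complex.ext_iff] at this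
    simp at this
    exact ⟨this.1, by linarith⟩
  exact ⟨by ext i j; exact (key i j).1, by ext i j; exact (key i j).2⟩

/-- Transposition preserves positivity, fixes the symmetric V and reverses the antisymmetric Ω. -/
lemma posSemidef_neg {V Ω : Matrix ι ι ℝ} (h : (uncertaintyMatrix V Ω).PosSemidef) :
    (uncertaintyMatrix V (-Ω)).PosSemidef := by
  have hs := isSymm_of_posSemidef h
  have : (uncertaintyMatrix V Ω)ᵀ = uncertaintyMatrix V (-Ω) := by
    rw [← hs.2]
    conv_rhs => rw [← hs.1]
    rfl
  exact this ▸ h.transpose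

/-- V + itΩ is the convex combination of V + iΩ and V - iΩ with weights (1 ± t)/2. This is where the
bound ν ≤ 1 is needed. -/
lemma posSemidef_smul {V Ω : Matrix ι ι ℝ} (h : (uncertaintyMatrix V Ω).PosSemidef) {t : ℝ}
    (ht : |t| ≤ 1) : (uncertaintyMatrix V (t • Ω)).PosSemidef := by
  obtain ⟨h1, h2⟩ := abs_le.mp ht
  have e : uncertaintyMatrix V (t • Ω) = (((1 + t) / 2 : ℝ) : ℂ) • uncertaintyMatrix V Ω +
      (((1 - t) / 2 : ℝ) : ℂ) • uncertaintyMatrix V (-Ω) := by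
    rw [← uncertaintyMatrix_smul, ← uncertaintyMatrix_smul, ← uncertaintyMatrix_add]
    congr 1
    · rw [← add_smul]; ring_nf; simp
    · rw [smul_neg, ← sub_eq_add_neg, ← sub_smul]; ring_nf
  rw [e]
  refine (h.smul ?_).add ((posSemidef_neg h).smul ?_)
  · exact_mod_cast (by linarith : (0 : ℝ) ≤ (1 + t) / 2)
  · exact_mod_cast (by linarith : (0 : ℝ) ≤ (1 - t) / 2)

lemma uncertaintyMatrix_conj [Fintype ι] (T : Matrix κ ι ℝ) (V Ω : Matrix ι ι ℝ) :
    uncertaintyMatrix (T * V * Tᵀ) (T * Ω * Tᵀ) =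
      T.map Complex.ofReal * uncertaintyMatrix V Ω * (T.map Complex.ofReal)ᴴ := by
  have hT : (T.map Complex.ofReal)ᴴ = Tᵀ.map Complex.ofReal := by
    ext i j; simp
  have hm : ∀ {α β γ : Type} [Fintype β] (A : Matrix α β ℝ) (B : Matrix β γ ℝ),
      (A * B).map Complex.ofReal = A.map Complex.ofReal * B.map Complex.ofReal :=
    fun A B => Matrix.map_mul (f := Complex.ofRealHom)
  rw [hT, uncertaintyMatrix, uncertaintyMatrix, hm, hm, hm, hm, Matrix.mul_add, Matrix.add_mul,
    Matrix.mul_smul, Matrix.smul_mul]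

lemma posSemidef_conj [Fintype ι] [Fintype κ] {V Ω : Matrix ι ι ℝ}
    (h : (uncertaintyMatrix V Ω).PosSemidef)
    (T : Matrix κ ι ℝ) : (uncertaintyMatrix (T * V * Tᵀ) (T * Ω * Tᵀ)).PosSemidef := by
  rw [uncertaintyMatrix_conj]
  exact h.mul_mul_conjTranspose_same _

lemma posSemidef_dsum [Fintype ι] [Fintype κ] {V Ω : Matrix ι ι ℝ} {V' Ω' : Matrix κ κ ℝ}
    (h : (uncertaintyMatrix V Ω).PosSemidef) (h' : (uncertaintyMatrix V' Ω').PosSemidef) :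
    (uncertaintyMatrix (dsum V V') (dsum Ω Ω')).PosSemidef := by
  have e : uncertaintyMatrix (dsum V V') (dsum Ω Ω') =
      fromBlocks (uncertaintyMatrix V Ω) 0 0 (uncertaintyMatrix V' Ω') := by
    ext (i | i) (j | j) <;> simp [uncertaintyMatrix_apply, dsum]
  rw [e]
  refine .of_dotProduct_mulVec_nonneg ?_ fun x => ?_
  · exact IsHermitian.fromBlocks h.1 (by simp) h'.1
  · rw [← Sum.elim_comp_inl_inr x, fromBlocks_mulVec]
    have : star (Sum.elim (x ∘ Sum.inl) (x ∘ Sum.inr)) =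
        Sum.elim (star (x ∘ Sum.inl)) (star (x ∘ Sum.inr)) := by
      ext (i | i) <;> rfl
    rw [this, sumElim_dotProduct_sumElim]
    simpa using add_nonneg (h.dotProduct_mulVec_nonneg (x ∘ Sum.inl))
      (h'.dotProduct_mulVec_nonneg (x ∘ Sum.inr))

lemma posSemidef_submatrix {V Ω : Matrix ι ι ℝ}
    (h : (uncertaintyMatrix V Ω).PosSemidef) (e : κ → ι) :
    (uncertaintyMatrix (V.submatrix e e) (Ω.submatrix e e)).PosSemidef :=
  h.submatrix e

lemma posSemidef_map_ofReal {V Ω : Matrix ι ι ℝ} (h : (uncertaintyMatrix V Ω).PosSemidef) :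
    (V.map Complex.ofReal).PosSemidef := by
  simpa [uncertaintyMatrix] using posSemidef_smul h (t := 0) (by simp)

/-- The nonnegative forms of V ± iΩ add up to twice that of V, so a null vector of V is killed by
both, hence by the invertible Ω. -/
lemma posDef_map_ofReal [Fintype ι] [DecidableEq ι] {V Ω : Matrix ι ι ℝ}
    (h : (uncertaintyMatrix V Ω).PosSemidef) (hΩ : IsUnit Ω) :
    (V.map Complex.ofReal).PosDef := by
  have hV := posSemidef_map_ofReal h
  refine .of_dotProduct_mulVec_pos hV.1 fun x hx => ?_
  refine lt_of_le_of_ne (hV.dotProduct_mulVec_nonneg x) fun h0 => hx ?_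
  have h' := posSemidef_neg h
  have e : uncertaintyMatrix V Ω + uncertaintyMatrix V (-Ω) = (2 : ℂ) • V.map Complex.ofReal := by
    ext i j; simp [uncertaintyMatrix_apply]; ring
  have e1 : star x ⬝ᵥ uncertaintyMatrix V Ω *ᵥ x + star x ⬝ᵥ uncertaintyMatrix V (-Ω) *ᵥ x = 0 := by
    rw [← dotProduct_add, ← add_mulVec, e, smul_mulVec, dotProduct_smul, ← h0, smul_zero]
  have e2 := (add_eq_zero_iff_of_nonneg (h.dotProduct_mulVec_nonneg x)
    (h'.dotProduct_mulVec_nonneg x)).mp e1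
  have e3 := (h.dotProduct_mulVec_zero_iff x).mp e2.1
  have e4 := (h'.dotProduct_mulVec_zero_iff x).mp e2.2
  have e5 : (2 * Complex.I) • (Ω.map Complex.ofReal *ᵥ x) = 0 := by
    have e7 : (2 * Complex.I) • Ω.map Complex.ofReal =
        uncertaintyMatrix V Ω - uncertaintyMatrix V (-Ω) := by
      ext i j; simp [uncertaintyMatrix_apply]; ring
    rw [← smul_mulVec, e7, sub_mulVec, e3, e4, sub_zero]
  have e6 : Ω.map Complex.ofReal *ᵥ x = 0 := by
    simpa using e5
  have hu : IsUnit (Ω.map Complex.ofReal) := hΩ.map (Complex.ofRealHom.mapMatrix (m := ι))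
  exact mulVec_injective_of_isUnit hu (by rw [e6, mulVec_zero])

lemma posSemidef_of_map_ofReal [Fintype ι] {V : Matrix ι ι ℝ}
    (h : (V.map Complex.ofReal).PosSemidef) : V.PosSemidef := by
  refine .of_dotProduct_mulVec_nonneg ?_ fun x => ?_
  · ext i j
    have := h.1.apply i j
    simpa using this
  · have := h.dotProduct_mulVec_nonneg (fun i => (x i : ℂ))
    have e : star (fun i => (x i : ℂ)) ⬝ᵥ V.map Complex.ofReal *ᵥ (fun i => (x i : ℂ)) =
        ((star x ⬝ᵥ V *ᵥ x : ℝ) : ℂ) := by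
      simp [dotProduct, mulVec]
    rw [e] at this
    exact_mod_cast this

lemma posDef_of_map_ofReal [Fintype ι] [DecidableEq ι] {V : Matrix ι ι ℝ}
    (h : (V.map Complex.ofReal).PosDef) : V.PosDef := by
  rw [(posSemidef_of_map_ofReal h.posSemidef).posDef_iff_det_ne_zero]
  have := h.posSemidef.posDef_iff_det_ne_zero.mp h
  have e : (V.map Complex.ofReal).det = (V.det : ℂ) := (Complex.ofRealHom.map_det V).symm
  rw [e] at this
  exact_mod_cast this

end Uncertainty

/-! ### The lowest symplectic eigenvalue -/

lemma mem_spectrum_of_mulVec {n : Type} [Fintype n] [DecidableEq n] {A : Matrix n n ℂ} {v : n → ℂ}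
    {z : ℂ} (hv : v ≠ 0) (h : A *ᵥ v = z • v) : z ∈ spectrum ℂ A := by
  rw [spectrum.mem_iff]
  intro hu
  refine hv (mulVec_injective_of_isUnit hu ?_)
  rw [mulVec_zero, sub_mulVec, h, Algebra.algebraMap_eq_smul_one, smul_mulVec, one_mulVec, sub_self]

/-- A lower bound `ν` on the symplectic eigenvalues of `V` gives `V + i ν Ω ≥ 0`. -/
lemma posSemidef_of_le_spectrum {n : Type} [Fintype n] [DecidableEq n] {V Ω : Matrix n n ℝ}
    (hV : (V.map Complex.ofReal).PosDef) (hΩ : Ω * Ω = -1) (hΩT : Ωᵀ = -Ω) {ν : ℝ} (hν : 0 ≤ ν)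
    (hs : ∀ z ∈ spectrum ℂ (Complex.I • (Ω * V).map Complex.ofReal), ν ≤ ‖z‖) :
    (uncertaintyMatrix V (ν • Ω)).PosSemidef := by
  rcases hν.eq_or_lt with rfl | hν
  · simpa [uncertaintyMatrix] using hV.posSemidef
  set W : Matrix n n ℂ := V.map Complex.ofReal with hW
  set H : Matrix n n ℂ := Complex.I • Ω.map Complex.ofReal with hH
  have hHH : H * H = 1 := by
    have : Ω.map Complex.ofReal * Ω.map Complex.ofReal = -1 := by
      have := congrArg (Complex.ofRealHom.mapMatrix (m := n)) hΩ
      rwa [map_mul, map_neg, map_one] at this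
    rw [hH, Matrix.smul_mul, Matrix.mul_smul, this, smul_smul, Complex.I_mul_I]
    simp
  have hHV : Complex.I • (Ω * V).map Complex.ofReal = H * W := by
    rw [hH, Matrix.smul_mul]
    congr 1
    exact Matrix.map_mul (f := Complex.ofRealHom)
  have hHh : H.IsHermitian := by
    ext i j
    have := congrFun (congrFun hΩT i) j
    simp only [transpose_apply, Matrix.neg_apply] at this
    simp [hH, this]
  rw [hHV] at hs
  have hC : uncertaintyMatrix V (ν • Ω) = W + (ν : ℂ) • H := by
    ext i j; simp [uncertaintyMatrix_apply, hW, hH]; ring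
  rw [hC]
  obtain ⟨B, hBu, hB⟩ : ∃ B : Matrix n n ℂ, IsUnit B ∧ W = star B * B := by
    open scoped MatrixOrder in
    obtain ⟨B, hB⟩ := CStarAlgebra.nonneg_iff_eq_star_mul_self.mp hV.posSemidef.nonneg
    refine ⟨B, ?_, hB⟩
    have := hV.isUnit
    rw [hB, isUnit_iff_isUnit_det, det_mul] at this
    exact (isUnit_iff_isUnit_det _).mpr (isUnit_of_mul_isUnit_right this)
  have hBd := (isUnit_iff_isUnit_det _).mp hBu
  -- With H = iΩ and W = B*B, a negative eigenvalue μ of M, with eigenvector v, makes w = B⁻¹v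
  -- satisfy νHw = (μ - 1)Ww. As H² = 1, w is an eigenvector of HW with eigenvalue ν/(μ - 1), of
  -- modulus ν/(1 - μ) < ν: a contradiction.
  set M : Matrix n n ℂ := (B⁻¹)ᴴ * (W + (ν : ℂ) • H) * B⁻¹ with hM
  have hWH : (W + (ν : ℂ) • H).IsHermitian := by
    refine hV.1.add ?_
    rw [IsHermitian, conjTranspose_smul, hHh.eq]
    simp
  have hMh : M.IsHermitian := isHermitian_conjTranspose_mul_mul _ hWH
  have hMB : Bᴴ * M * B = W + (ν : ℂ) • H := by
    have h1 : Bᴴ * (B⁻¹)ᴴ = 1 := by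
      rw [← conjTranspose_mul, nonsing_inv_mul _ hBd, conjTranspose_one]
    calc Bᴴ * M * B = (Bᴴ * (B⁻¹)ᴴ) * (W + (ν : ℂ) • H) * (B⁻¹ * B) := by
          simp only [hM, Matrix.mul_assoc]
      _ = _ := by rw [h1, nonsing_inv_mul _ hBd, Matrix.one_mul, Matrix.mul_one]
  rw [← hMB]
  refine PosSemidef.conjTranspose_mul_mul_same ?_ B
  rw [hMh.posSemidef_iff_eigenvalues_nonneg]
  intro j
  by_contra hneg
  have hneg : hMh.eigenvalues j < 0 := not_le.mp hneg
  set μ := hMh.eigenvalues j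
  set v : n → ℂ := ⇑(hMh.eigenvectorBasis j) with hv
  have hv0 : v ≠ 0 := fun h => hMh.eigenvectorBasis.orthonormal.ne_zero j (by
    ext i; exact congrFun h i)
  have hMv : M *ᵥ v = (μ : ℂ) • v := by
    have := hMh.mulVec_eigenvectorBasis j
    rw [← hv] at this
    rw [this]
    ext i; simp [μ]
  set w : n → ℂ := B⁻¹ *ᵥ v with hw
  have hBw : B *ᵥ w = v := by
    rw [hw, mulVec_mulVec, mul_nonsing_inv _ hBd, one_mulVec]
  have hw0 : w ≠ 0 := fun h => hv0 (by rw [← hBw, h, mulVec_zero])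
  have h1 : (W + (ν : ℂ) • H) *ᵥ w = (μ : ℂ) • (W *ᵥ w) := by
    rw [← hMB, hB, star_eq_conjTranspose, ← mulVec_mulVec, ← mulVec_mulVec, hBw, hMv, mulVec_smul,
      ← mulVec_mulVec, hBw]
  have h2 : (ν : ℂ) • w = ((μ : ℂ) - 1) • ((H * W) *ᵥ w) := by
    have h3 : (ν : ℂ) • (H *ᵥ w) = ((μ : ℂ) - 1) • (W *ᵥ w) := by
      rw [sub_smul, ← h1, add_mulVec, one_smul, add_sub_cancel_left, smul_mulVec (ν : ℂ) H w]
    have h4 := congrArg (H *ᵥ ·) h3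
    simpa only [mulVec_smul, mulVec_mulVec, hHH, one_mulVec] using h4
  have hμ1 : (μ : ℂ) - 1 ≠ 0 := by
    have : μ - 1 ≠ 0 := by linarith
    exact_mod_cast this
  have h5 : (H * W) *ᵥ w = ((ν : ℂ) / ((μ : ℂ) - 1)) • w := by
    rw [div_eq_inv_mul, mul_smul, h2, smul_smul, inv_mul_cancel₀ hμ1, one_smul]
  have h6 := hs _ (mem_spectrum_of_mulVec hw0 h5)
  have h7 : ‖(ν : ℂ) / ((μ : ℂ) - 1)‖ = ν / (1 - μ) := by
    rw [norm_div, ← Complex.ofReal_one, ← Complex.ofReal_sub, Complex.norm_real, Complex.norm_real,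
      Real.norm_of_nonneg hν.le, Real.norm_eq_abs, abs_of_neg (by linarith), neg_sub]
  rw [h7, le_div_iff₀ (by linarith)] at h6
  nlinarith

/-! ### Commutation matrices -/

section Forms

variable {ι κ : Type}

lemma dsum_mul [Fintype ι] [Fintype κ] (A A' : Matrix ι ι ℝ) (B B' : Matrix κ κ ℝ) :
    dsum A B * dsum A' B' = dsum (A * A') (B * B') := by
  simp [dsum, fromBlocks_multiply]

lemma dsum_transpose (A : Matrix ι ι ℝ) (B : Matrix κ κ ℝ) : (dsum A B)ᵀ = dsum Aᵀ Bᵀ := by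
  simp [dsum, fromBlocks_transpose]

lemma smul_dsum (t : ℝ) (A : Matrix ι ι ℝ) (B : Matrix κ κ ℝ) :
    t • dsum A B = dsum (t • A) (t • B) := by
  simp [dsum, fromBlocks_smul]

lemma dsum_neg (A : Matrix ι ι ℝ) (B : Matrix κ κ ℝ) : dsum (-A) (-B) = -dsum A B := by
  simp [dsum, fromBlocks_neg]

lemma dsum_one [DecidableEq ι] [DecidableEq κ] :
    dsum (1 : Matrix ι ι ℝ) (1 : Matrix κ κ ℝ) = 1 :=
  fromBlocks_one

lemma dsum_mul_self_eq_neg_one [Fintype ι] [Fintype κ] [DecidableEq ι] [DecidableEq κ]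
    {A : Matrix ι ι ℝ} {B : Matrix κ κ ℝ} (hA : A * A = -1) (hB : B * B = -1) :
    dsum A B * dsum A B = -1 := by
  rw [dsum_mul, hA, hB, dsum_neg, dsum_one]

lemma J_mul_self : J * J = -1 := by
  ext i j
  fin_cases i <;> fin_cases j <;> simp [J]

lemma J_transpose : Jᵀ = -J := by
  ext i j
  fin_cases i <;> fin_cases j <;> simp [J]

lemma Z_mul_self : Z * Z = 1 := by
  ext i j
  fin_cases i <;> fin_cases j <;> simp [Z]

lemma Z_transpose : Zᵀ = Z := by
  ext i j
  fin_cases i <;> fin_cases j <;> simp [Z]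

lemma Z_mul_J_mul_Z : Z * J * Z = -J := by
  ext i j
  fin_cases i <;> fin_cases j <;> simp [Z, J]

open scoped Kronecker in
lemma modesForm_mul_self (k : ℕ) : modesForm k * modesForm k = -1 := by
  have e : modesForm k = (1 : Matrix (Fin k) (Fin k) ℝ) ⊗ₖ J := by
    ext a b
    simp [modesForm, one_apply]
  rw [e, ← mul_kronecker_mul, J_mul_self, ← neg_one_smul ℝ (1 : Matrix (Fin 2) (Fin 2) ℝ),
    kronecker_smul, Matrix.one_mul, one_kronecker_one, neg_one_smul]

lemma ancForm_mul_self (nd np nh : ℕ) : ancForm nd np nh * ancForm nd np nh = -1 :=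
  dsum_mul_self_eq_neg_one (modesForm_mul_self nd)
    (dsum_mul_self_eq_neg_one (modesForm_mul_self np) (modesForm_mul_self nh))

lemma isUnit_of_mul_self_eq_neg_one [Fintype ι] [DecidableEq ι] {Ω : Matrix ι ι ℝ}
    (h : Ω * Ω = -1) : IsUnit Ω :=
  IsUnit.of_mul_eq_one (-Ω) (by rw [Matrix.mul_neg, h, neg_neg])

end Forms

/-! ### Schur complements -/

/-- Conditioning on quadratures with vanishing commutators preserves uncertainty relations. -/
lemma posSemidef_schurComplement {ι κ : Type} [Fintype ι] [Fintype κ] [DecidableEq ι]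
    [DecidableEq κ] {A Ω : Matrix ι ι ℝ} {B : Matrix ι κ ℝ} {C : Matrix κ ι ℝ} {D : Matrix κ κ ℝ}
    (hD : IsUnit D) (h : (uncertaintyMatrix (fromBlocks A B C D) (dsum Ω 0)).PosSemidef) :
    (uncertaintyMatrix (A - B * D⁻¹ * C) Ω).PosSemidef := by
  have hsymm := (isSymm_of_posSemidef h).1
  rw [fromBlocks_transpose, fromBlocks_inj] at hsymm
  obtain ⟨-, hB, -, hDT⟩ := hsymm
  have hdet := (isUnit_iff_isUnit_det _).mp hD
  -- T subtracts from the kept quadratures their best linear prediction from the conditioned ones.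
  -- The zero block of the form makes this subtraction invisible to the commutators.
  set T : Matrix ι (ι ⊕ κ) ℝ := fromCols 1 (-(B * D⁻¹)) with hT
  have key := posSemidef_conj h T
  have hTt : Tᵀ = fromRows 1 (-(D⁻¹ * C)) := by
    rw [hT, transpose_fromCols, transpose_one, transpose_neg, transpose_mul, transpose_nonsing_inv,
      hDT, ← hB, transpose_transpose]
  have h1 : T * fromBlocks A B C D * Tᵀ = A - B * D⁻¹ * C := by
    have : B * D⁻¹ * D = B := nonsing_inv_mul_cancel_right _ _ hdet
    rw [hTt, hT, fromCols_mul_fromBlocks, fromCols_mul_fromRows]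
    simp only [Matrix.one_mul, Matrix.mul_one, Matrix.neg_mul, Matrix.mul_neg, this]
    simp [sub_eq_add_neg]
  have h2 : T * dsum Ω (0 : Matrix κ κ ℝ) * Tᵀ = Ω := by
    rw [hTt, hT, dsum, fromCols_mul_fromBlocks, fromCols_mul_fromRows]
    simp
  rwa [h1, h2] at key

/-! ### Local Gaussian completely positive maps and uncertainty relations -/

lemma GCPMap.meas_injective (E : GCPMap) : Function.Injective E.meas := by
  rintro (a | a) (b | b) h <;> simp_all [GCPMap.meas]

/-- The commutation matrix of all modes held by one party. -/
def GCPMap.totalForm (E : GCPMap) : Matrix E.Total E.Total ℝ := dsum J (ancForm E.nd E.np E.nh)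

lemma GCPMap.totalForm_mul_self (E : GCPMap) : E.totalForm * E.totalForm = -1 :=
  dsum_mul_self_eq_neg_one J_mul_self (ancForm_mul_self _ _ _)

lemma dilatedCov_posSemidef (EA EB : GCPMap) {V : Matrix (Fin 2 ⊕ Fin 2) (Fin 2 ⊕ Fin 2) ℝ}
    {s t : ℝ} (hs : |s| ≤ 1) (ht : |t| ≤ 1)
    (hV : (uncertaintyMatrix V (dsum (s • J) (t • J))).PosSemidef) :
    (uncertaintyMatrix (dilatedCov EA EB V)
      (dsum (s • EA.totalForm) (t • EB.totalForm))).PosSemidef := by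
  have hA := posSemidef_smul (V := EA.σ) EA.hσ.2 hs
  have hB := posSemidef_smul (V := EB.σ) EB.hσ.2 ht
  have h := posSemidef_conj (posSemidef_submatrix (posSemidef_dsum hV (posSemidef_dsum hA hB))
    (Equiv.sumSumSumComm (Fin 2) (Fin 2) (Anc EA.nd EA.np EA.nh) (Anc EB.nd EB.np EB.nh)).symm)
    (dsum EA.S EB.S)
  have e : (dsum (dsum (s • J) (t • J))
      (dsum (s • ancForm EA.nd EA.np EA.nh) (t • ancForm EB.nd EB.np EB.nh))).submatrix
      (Equiv.sumSumSumComm _ _ _ _).symm (Equiv.sumSumSumComm _ _ _ _).symm =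
      dsum (s • EA.totalForm) (t • EB.totalForm) := by
    ext ((i | i) | (i | i)) ((j | j) | (j | j)) <;> simp [dsum, GCPMap.totalForm]
  have hSA : EA.S * EA.totalForm * EA.Sᵀ = EA.totalForm := EA.hS
  have hSB : EB.S * EB.totalForm * EB.Sᵀ = EB.totalForm := EB.hS
  rw [e, dsum_transpose, dsum_mul, dsum_mul] at h
  simp only [Matrix.mul_smul, Matrix.smul_mul, hSA, hSB, ← dsum_transpose] at h
  exact h

/-- The minus sign is chosen to cancel the commutators of the measured quadratures once this
covariance is added to theirs. Homodyned x quadratures commute already, so zero covariance suffices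
for them. -/
lemma measCov_posSemidef (E : GCPMap) {t : ℝ} (ht : |t| ≤ 1) :
    (uncertaintyMatrix E.measCov
      (-(t • E.totalForm).submatrix E.meas E.meas)).PosSemidef := by
  have h := posSemidef_dsum (posSemidef_smul (V := E.γ) E.hγ.2 (t := -t) (by rwa [abs_neg]))
    (V' := (0 : Matrix (Fin E.nh) (Fin E.nh) ℝ)) (Ω' := 0)
    (by simpa [uncertaintyMatrix] using PosSemidef.zero)
  refine (congrArg (fun Ω => (uncertaintyMatrix E.measCov Ω).PosSemidef) ?_).mpr h
  ext (i | i) (j | j) <;>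
    simp [GCPMap.totalForm, GCPMap.meas, ancForm, dsum, modesForm, J]

/-- Local Gaussian completely positive maps preserve the uncertainty relations
`V + i (s J ⊕ t J) ≥ 0` with `|s|, |t| ≤ 1` of two-mode covariance matrices. -/
lemma localGCP_posSemidef (EA EB : GCPMap) {V : Matrix (Fin 2 ⊕ Fin 2) (Fin 2 ⊕ Fin 2) ℝ}
    (hV : IsCovariance (dsum J J) V) {s t : ℝ} (hs : |s| ≤ 1) (ht : |t| ≤ 1)
    (hst : (uncertaintyMatrix V (dsum (s • J) (t • J))).PosSemidef) :
    (uncertaintyMatrix (localGCP EA EB V) (dsum (s • J) (t • J))).PosSemidef := by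
  classical
  set W := dilatedCov EA EB V with hW
  set out : Fin 2 ⊕ Fin 2 → EA.Total ⊕ EB.Total := Sum.map Sum.inl Sum.inl with hout
  set mea : EA.Meas ⊕ EB.Meas → EA.Total ⊕ EB.Total := Sum.map EA.meas EB.meas with hmea
  -- The unscaled relation is used because s or t may vanish. Definiteness of W makes the inverse in
  -- `localGCP` a genuine one.
  have hWdef : W.PosDef := by
    have h1 := dilatedCov_posSemidef EA EB (V := V) (s := 1) (t := 1) (by simp) (by simp)
      (by rw [one_smul]; exact hV.2)
    rw [one_smul, one_smul] at h1
    exact posDef_of_map_ofReal (posDef_map_ofReal h1 (isUnit_of_mul_self_eq_neg_one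
      (dsum_mul_self_eq_neg_one EA.totalForm_mul_self EB.totalForm_mul_self)))
  have hM : ∀ {s t : ℝ}, |s| ≤ 1 → |t| ≤ 1 →
      (uncertaintyMatrix (dsum EA.measCov EB.measCov)
        (dsum (-(s • EA.totalForm).submatrix EA.meas EA.meas)
          (-(t • EB.totalForm).submatrix EB.meas EB.meas))).PosSemidef := fun hs ht =>
    posSemidef_dsum (measCov_posSemidef EA hs) (measCov_posSemidef EB ht)
  have hD : IsUnit (W.submatrix mea mea + dsum EA.measCov EB.measCov) :=
    ((hWdef.submatrix (EA.meas_injective.sumMap EB.meas_injective)).add_posSemidef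
      (posSemidef_of_map_ofReal (posSemidef_map_ofReal (hM hs ht)))).isUnit
  refine posSemidef_schurComplement hD ?_
  have h1 := posSemidef_submatrix (dilatedCov_posSemidef EA EB hs ht hst) (Sum.elim out mea)
  have h2 := posSemidef_dsum (V := (0 : Matrix (Fin 2 ⊕ Fin 2) (Fin 2 ⊕ Fin 2) ℝ)) (Ω := 0)
    (by simpa [uncertaintyMatrix] using PosSemidef.zero) (hM hs ht)
  have h3 := h1.add h2
  rw [← uncertaintyMatrix_add] at h3
  convert h3 using 2
  · ext (i | i) (j | j) <;> simp [dsum, hout, hmea]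
  · ext ((i | i) | ((i | i) | (i | i))) ((j | j) | ((j | j) | (j | j))) <;>
      simp [dsum, GCPMap.totalForm, GCPMap.meas, hout, hmea]

/-! ### Gaussian integrals and the fidelity -/

lemma integral_comp_mulVec {ι : Type} [Fintype ι] [DecidableEq ι] {B : Matrix ι ι ℝ}
    (hB : B.det ≠ 0) (g : (ι → ℝ) → ℝ) : ∫ x, g (B *ᵥ x) = |B.det|⁻¹ * ∫ y, g y := by
  have hemb : MeasurableEmbedding (toLin' B) := by
    have hinj : Function.Injective (toLin' B) := by
      rw [toLin'_apply']
      exact mulVec_injective_of_isUnit ((isUnit_iff_isUnit_det _).mpr hB.isUnit)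
    exact ((toLin' B).isClosedEmbedding_of_injective
      (LinearMap.ker_eq_bot.mpr hinj)).measurableEmbedding
  have h := hemb.integral_map (μ := MeasureTheory.volume) g
  rw [Real.map_matrix_volume_pi_eq_smul_volume_pi hB, MeasureTheory.integral_smul_measure,
    ENNReal.toReal_ofReal (abs_nonneg _), abs_inv, smul_eq_mul] at h
  rw [h]
  rfl

/-- Writing M = BᵀB, the substitution y = Bx splits the integral into one-dimensional Gaussians. -/
lemma integral_exp_neg_quadratic {ι : Type} [Fintype ι] [DecidableEq ι] {M : Matrix ι ι ℝ}
    (hM : M.PosDef) {b : ℝ} :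
    ∫ x : ι → ℝ, Real.exp (-b * (x ⬝ᵥ M *ᵥ x)) =
      √(Real.pi / b) ^ Fintype.card ι / √M.det := by
  obtain ⟨B, hB⟩ : ∃ B : Matrix ι ι ℝ, M = Bᵀ * B := by
    open scoped MatrixOrder in
    obtain ⟨B, hB⟩ := CStarAlgebra.nonneg_iff_eq_star_mul_self.mp hM.posSemidef.nonneg
    exact ⟨B, by simpa [star_eq_conjTranspose] using hB⟩
  have hdet : M.det = B.det ^ 2 := by rw [hB, det_mul, det_transpose, sq]
  have hB0 : B.det ≠ 0 := fun h => hM.det_pos.ne' (by rw [hdet, h]; simp)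
  let g : (ι → ℝ) → ℝ := fun y => ∏ i, Real.exp (-b * y i ^ 2)
  have e : ∀ x : ι → ℝ, Real.exp (-b * (x ⬝ᵥ M *ᵥ x)) =
      g (B *ᵥ x) := fun x => by
    have : x ⬝ᵥ M *ᵥ x = ∑ i, (B *ᵥ x) i ^ 2 := by
      rw [hB, ← mulVec_mulVec, dotProduct_mulVec, vecMul_transpose, dotProduct]
      simp [sq]
    simp only [g, this, Finset.mul_sum, Real.exp_sum]
  simp_rw [e]
  rw [integral_comp_mulVec hB0, MeasureTheory.integral_fintype_prod_volume_eq_pow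
    (fun t : ℝ => Real.exp (-b * t ^ 2)), integral_gaussian, hdet, Real.sqrt_sq_eq_abs]
  field_simp

/-- The coefficients of the quadratures `x_b + x_a` and `p_b - p_a`. -/
def noiseQuadratures : Matrix (Fin 2) (Fin 2 ⊕ Fin 2) ℝ := fromCols Z 1

lemma noiseQuadratures_transpose : noiseQuadraturesᵀ = fromRows Z 1 := by
  rw [noiseQuadratures, transpose_fromCols, Z_transpose, transpose_one]

/-- The covariance matrix of the quadratures `x_b + x_a` and `p_b - p_a`. -/
def noiseCov (V : Matrix (Fin 2 ⊕ Fin 2) (Fin 2 ⊕ Fin 2) ℝ) : Matrix (Fin 2) (Fin 2) ℝ :=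
  noiseQuadratures * V * noiseQuadraturesᵀ

lemma dotProduct_noiseCov (V : Matrix (Fin 2 ⊕ Fin 2) (Fin 2 ⊕ Fin 2) ℝ) (ξ : Fin 2 → ℝ) :
    ξ ⬝ᵥ noiseCov V *ᵥ ξ = Sum.elim (Z *ᵥ ξ) ξ ⬝ᵥ V *ᵥ Sum.elim (Z *ᵥ ξ) ξ := by
  have h : Sum.elim (Z *ᵥ ξ) ξ = noiseQuadraturesᵀ *ᵥ ξ := by
    rw [noiseQuadratures_transpose, fromRows_mulVec, one_mulVec]
  rw [h, noiseCov, ← mulVec_mulVec, ← mulVec_mulVec, dotProduct_mulVec, mulVec_transpose]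

/-- The displacement phases at ξ and -ξ cancel, and the two coherent-state factors contribute the
summand 2 to the quadratic form. The prefactor is 4π/(2π) = 2. -/
lemma fidelity_eq {V : Matrix (Fin 2 ⊕ Fin 2) (Fin 2 ⊕ Fin 2) ℝ}
    (hN : (noiseCov V).PosSemidef) (d : Fin 2 → ℝ) :
    fidelity V d = 2 / √((2 : ℝ) • (1 : Matrix (Fin 2) (Fin 2) ℝ) + noiseCov V).det := by
  have hM : ((2 : ℝ) • (1 : Matrix (Fin 2) (Fin 2) ℝ) + noiseCov V).PosDef :=
    (PosDef.one.smul two_pos).add_posSemidef hN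
  set M := (2 : ℝ) • (1 : Matrix (Fin 2) (Fin 2) ℝ) + noiseCov V with hMdef
  have e : ∀ ξ : Fin 2 → ℝ, gaussianChar 1 d (-ξ) *
      teleportedChar (gaussianChar 1 d) (gaussianChar V 0) ξ =
      ((Real.exp (-(1 / 4) * (ξ ⬝ᵥ M *ᵥ ξ)) : ℝ) : ℂ) := fun ξ => by
    rw [hMdef, add_mulVec, dotProduct_add, dotProduct_noiseCov, smul_mulVec, one_mulVec,
      dotProduct_smul]
    simp only [teleportedChar, gaussianChar, one_mulVec, neg_dotProduct, dotProduct_neg,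
      zero_dotProduct, neg_neg, ← Complex.exp_add, Complex.ofReal_exp]
    congr 1
    push_cast
    simp only [smul_eq_mul]
    push_cast
    ring
  rw [fidelity, overlap]
  simp_rw [e]
  rw [integral_complex_ofReal, ← Complex.ofReal_mul, Complex.ofReal_re,
    integral_exp_neg_quadratic hM, Fintype.card_fin, Real.sq_sqrt (by positivity)]
  field_simp
  norm_num

lemma two_mul_one_add_sq_le_det {N : Matrix (Fin 2) (Fin 2) ℝ} {ν : ℝ}
    (h : (uncertaintyMatrix N ((2 * ν) • J)).PosSemidef) :
    (2 * (1 + ν)) ^ 2 ≤ ((2 : ℝ) • (1 : Matrix (Fin 2) (Fin 2) ℝ) + N).det := by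
  have hN := posSemidef_of_map_ofReal (posSemidef_map_ofReal h)
  have h0 : 0 ≤ N 0 0 := hN.diag_nonneg
  have h1 : 0 ≤ N 1 1 := hN.diag_nonneg
  have hs : N 1 0 = N 0 1 := by simpa using hN.1.apply 0 1
  -- This determinant equals det N - 4ν²; the trace bound follows from it by (tr N)² ≥ 4 det N, and
  -- det(2 + N) = 4 + 2 tr N + det N.
  have hdet := (Complex.le_def.mp h.det_nonneg).1
  rw [det_fin_two] at hdet
  simp [uncertaintyMatrix_apply, J, hs] at hdet
  have hd : (2 * ν) ^ 2 ≤ N 0 0 * N 1 1 - N 0 1 ^ 2 := by nlinarith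
  have ht : 4 * ν ≤ N 0 0 + N 1 1 := by
    refine abs_le_of_sq_le_sq' ?_ (by positivity) |>.2
    nlinarith [sq_nonneg (N 0 0 - N 1 1), sq_nonneg (N 0 1)]
  rw [det_fin_two]
  simp [hs]
  nlinarith

/-! ### The upper bound -/

lemma lowestPTSymplecticEigenvalue_nonneg (V : Matrix (Fin 2 ⊕ Fin 2) (Fin 2 ⊕ Fin 2) ℝ) :
    0 ≤ lowestPTSymplecticEigenvalue V := by
  refine Real.sInf_nonneg ?_
  rintro _ ⟨z, -, rfl⟩
  exact norm_nonneg z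

lemma lowestPTSymplecticEigenvalue_le {V : Matrix (Fin 2 ⊕ Fin 2) (Fin 2 ⊕ Fin 2) ℝ} {z : ℂ}
    (hz : z ∈ spectrum ℂ (Complex.I • (dsum J J * partialTranspose V).map Complex.ofReal)) :
    lowestPTSymplecticEigenvalue V ≤ ‖z‖ := by
  refine csInf_le ⟨0, ?_⟩ ⟨z, hz, rfl⟩
  rintro _ ⟨z, -, rfl⟩
  exact norm_nonneg z

lemma posSemidef_lowestPTSymplecticEigenvalue {V : Matrix (Fin 2 ⊕ Fin 2) (Fin 2 ⊕ Fin 2) ℝ}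
    (hV : IsCovariance (dsum J J) V) :
    (uncertaintyMatrix V (dsum (-lowestPTSymplecticEigenvalue V • J)
      (lowestPTSymplecticEigenvalue V • J))).PosSemidef := by
  set ν := lowestPTSymplecticEigenvalue V
  have hΛt : (dsum Z (1 : Matrix (Fin 2) (Fin 2) ℝ))ᵀ = dsum Z 1 := by
    rw [dsum_transpose, Z_transpose, transpose_one]
  have hΛ : dsum Z (1 : Matrix (Fin 2) (Fin 2) ℝ) * dsum Z 1 = 1 := by
    rw [dsum_mul, Z_mul_self, Matrix.one_mul, dsum_one]
  have hJJ := dsum_mul_self_eq_neg_one J_mul_self J_mul_self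
  -- The partial transpose may violate the relation for J ⊕ J, so definiteness is drawn from the
  -- reflected form Λ(J ⊕ J)Λ.
  have hPT : ((partialTranspose V).map Complex.ofReal).PosDef := by
    have h := posSemidef_conj (V := V) (Ω := dsum J J) hV.2 (dsum Z 1)
    refine posDef_map_ofReal (V := partialTranspose V)
      (Ω := dsum Z 1 * dsum J J * (dsum Z 1)ᵀ) (by rwa [hΛt] at h ⊢) ?_
    rw [hΛt]
    exact ((IsUnit.of_mul_eq_one _ hΛ).mul (isUnit_of_mul_self_eq_neg_one hJJ)).mul
      (IsUnit.of_mul_eq_one _ hΛ)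
  have h := posSemidef_conj (posSemidef_of_le_spectrum hPT hJJ
    (by rw [dsum_transpose, J_transpose, dsum_neg]) (lowestPTSymplecticEigenvalue_nonneg V)
    fun z hz => lowestPTSymplecticEigenvalue_le hz) (dsum Z 1)
  have e1 : dsum Z 1 * partialTranspose V * (dsum Z 1)ᵀ = V := by
    rw [hΛt, partialTranspose]
    calc _ = (dsum Z (1 : Matrix (Fin 2) (Fin 2) ℝ) * dsum Z 1) * V *
          (dsum Z 1 * dsum Z 1) := by simp only [Matrix.mul_assoc]
      _ = V := by rw [hΛ, Matrix.one_mul, Matrix.mul_one]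
  have e2 : dsum Z 1 * (ν • dsum J J) * (dsum Z 1)ᵀ = dsum (-ν • J) (ν • J) := by
    rw [hΛt, smul_dsum, dsum_mul, dsum_mul, Matrix.mul_smul, Matrix.smul_mul, Z_mul_J_mul_Z]
    simp
  rwa [e1, e2] at h

/-- For the form J ⊕ J the two contributions would cancel, since x_b + x_a and p_b - p_a commute.
With Alice's sign reversed, ZJZ = -J makes them add up, whence the factor 2. -/
lemma noiseCov_posSemidef {V : Matrix (Fin 2 ⊕ Fin 2) (Fin 2 ⊕ Fin 2) ℝ} {ν : ℝ}
    (h : (uncertaintyMatrix V (dsum (-ν • J) (ν • J))).PosSemidef) :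
    (uncertaintyMatrix (noiseCov V) ((2 * ν) • J)).PosSemidef := by
  have h' := posSemidef_conj h noiseQuadratures
  have e : noiseQuadratures * dsum (-ν • J) (ν • J) * noiseQuadraturesᵀ = (2 * ν) • J := by
    rw [noiseQuadratures_transpose, noiseQuadratures, dsum, fromCols_mul_fromBlocks,
      fromCols_mul_fromRows]
    simp [Z_mul_J_mul_Z, two_mul, add_smul]
  rwa [e] at h'

lemma fidelity_localGCP_le {V : Matrix (Fin 2 ⊕ Fin 2) (Fin 2 ⊕ Fin 2) ℝ}
    (hV : IsCovariance (dsum J J) V) (hν1 : lowestPTSymplecticEigenvalue V ≤ 1) (d : Fin 2 → ℝ)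
    (EA EB : GCPMap) :
    fidelity (localGCP EA EB V) d ≤ 1 / (1 + lowestPTSymplecticEigenvalue V) := by
  have hν0 := lowestPTSymplecticEigenvalue_nonneg V
  have hPT := posSemidef_lowestPTSymplecticEigenvalue hV
  set ν := lowestPTSymplecticEigenvalue V
  have habs : |ν| ≤ 1 := by rwa [abs_of_nonneg hν0]
  have hN := noiseCov_posSemidef
    (localGCP_posSemidef EA EB hV (by rwa [abs_neg]) habs hPT)
  rw [fidelity_eq (posSemidef_of_map_ofReal (posSemidef_map_ofReal hN))]
  have h1 : 2 * (1 + ν) ≤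
      √((2 : ℝ) • (1 : Matrix (Fin 2) (Fin 2) ℝ) + noiseCov (localGCP EA EB V)).det :=
    Real.le_sqrt_of_sq_le (two_mul_one_add_sq_le_det hN)
  calc _ ≤ 2 / (2 * (1 + ν)) := by gcongr
    _ = _ := by field_simp

end CVTeleportation
end

theorem theorem1
    (V : Matrix (Fin 2 ⊕ Fin 2) (Fin 2 ⊕ Fin 2) ℝ)
    (hV : CVTeleportation.IsCovariance
      (CVTeleportation.dsum CVTeleportation.J CVTeleportation.J) V)
    (ν : ℝ) (hν : ν = CVTeleportation.lowestPTSymplecticEigenvalue V) (hν1 : ν ≤ 1)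
    (d : Fin 2 → ℝ) :
    (∀ EA EB : CVTeleportation.GCPMap,
      CVTeleportation.fidelity (CVTeleportation.localGCP EA EB V) d ≤ 1 / (1 + ν)) ∧
    CVTeleportation.optimalFidelity V d ≤ 1 / (1 + ν) := by
  subst hν
  have h := CVTeleportation.fidelity_localGCP_le hV hν1 d
  refine ⟨h, Real.sSup_le ?_ ?_⟩
  · rintro _ ⟨EA, EB, rfl⟩
    exact h EA EB
  -- `Real.sSup_le` also asks for a nonnegative bound, because the real supremum of the empty set is
  -- 0.
  · have := CVTeleportation.lowestPTSymplecticEigenvalue_nonneg V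
    positivity
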